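/- Let $\varphi(-q)=\sum_{j=-\infty}^{\infty}(-1)^j q^{j^2}$ and define the integers $\overline{a}_5(n)$, $n\ge 0$, by $$\sum_{n=0}^{\infty}\overline{a}_5(n)q^n=\frac{\varphi(-q^5)^5}{\varphi(-q)}.$$ Then for every nonnegative integer $n$ and every integer $k\ge 2$, $$\overline{a}_5(20n+6)\equiv 0 \pmod{10},\qquad \overline{a}_5(20n+14)\equiv 0 \pmod{10},$$ and $$4\,\overline{a}_5(5^k n)\equiv 5\,\overline{a}_5(n)-\overline{a}_5(5n) \pmod{5^k}.$$ -/

import Mathlib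

/-- The integers `j` with `j ^ 2 = m`; they all lie in `[-m, m]`. -/
noncomputable def intSqrts (m : ℕ) : Finset ℤ :=
  (Finset.Icc (-(m : ℤ)) (m : ℤ)).filter (fun j => j ^ 2 = (m : ℤ))

theorem mem_intSqrts (m : ℕ) (j : ℤ) : j ∈ intSqrts m ↔ j ^ 2 = (m : ℤ) := by
  unfold intSqrts
  rw [Finset.mem_filter, Finset.mem_Icc]
  refine ⟨fun h => h.2, fun h => ⟨⟨?_, ?_⟩, h⟩⟩
  · have := Int.le_self_sq (-j)
    rw [neg_sq] at this
    omega
  · have := Int.le_self_sq j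
    omega

/-- The theta function `φ(-q) = ∑_{j ∈ ℤ} (-1)^j q^(j²)` as a formal power series in `q`:
the coefficient of `q^m` is the sum of `(-1)^j` over all integers `j` with `j² = m`. -/
noncomputable def phiNeg : PowerSeries ℤ :=
  PowerSeries.mk fun m => ∑ j ∈ intSqrts m, (-1 : ℤ) ^ j.natAbs

theorem constantCoeff_phiNeg : PowerSeries.constantCoeff phiNeg = ((1 : ℤˣ) : ℤ) := by
  rw [← PowerSeries.coeff_zero_eq_constantCoeff_apply, phiNeg, PowerSeries.coeff_mk]
  decide

/-- The quotient `φ(-q^t)^t / φ(-q)` for `t ≥ 1`. Here `φ(-q)` has constant term `1`, hence is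
invertible in `ℤ⟦q⟧`, and `invOfUnit phiNeg 1` is its inverse. -/
noncomputable def abarSeries (t : ℕ) (ht : t ≠ 0) : PowerSeries ℤ :=
  (PowerSeries.expand t ht phiNeg) ^ t * PowerSeries.invOfUnit phiNeg 1

/-- `abarSeries t` is indeed the quotient of `φ(-q^t)^t` by `φ(-q)`. -/
theorem abarSeries_mul_phiNeg (t : ℕ) (ht : t ≠ 0) :
    abarSeries t ht * phiNeg = (PowerSeries.expand t ht phiNeg) ^ t := by
  rw [abarSeries, mul_assoc, mul_comm (PowerSeries.invOfUnit phiNeg 1),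
    PowerSeries.mul_invOfUnit phiNeg 1 constantCoeff_phiNeg, mul_one]

/-- `ā₅(n)`: the coefficient of `q^n` in `φ(-q⁵)⁵ / φ(-q)`. -/
noncomputable def abar5 (n : ℕ) : ℤ :=
  PowerSeries.coeff n (abarSeries 5 (by decide))

/-! Write $\varphi(-q)=Z+X+Y$ with $Z=\varphi(-q^{25})$ and $X$, $Y$ the terms with exponent 1, 4
mod 5, and let $P=\varphi(-q^5)$. Two elementary facts about sums of two squares drive everything:
the Hecke relation at 5 gives $XY=P^2-Z^2$ (`thetaX_mul_thetaY`), and the 5-dissection of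
$\varphi(q)\varphi(-q)=\varphi(-q^2)^2$ relates $P,Z,X,Y$ to their images under $q\mapsto -q$.
Eliminating these images yields $Z(X^5+Y^5)$ as a polynomial in $P,Z$ (`thetaZ_mul_pow_five_add`),
equivalently $Z\prod_{\zeta^5=1}(Z+\zeta X+\zeta^{-1}Y)=P^6$.

Powers of 5: the norm formula turns $P^5/\varphi(-q)$ into a polynomial in $X,Y,Z$ over $P$, so its
5-dissection can be read off. Dissecting twice gives $\overline a_5(25n)=6\overline
a_5(5n)-5\overline a_5(n)$, whose characteristic roots are 1 and 5; solving it gives the congruence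
mod $5^k$.

Modulo 10: $\varphi(-q)\equiv 1$ mod 2 settles the factor 2. Modulo 5, Frobenius gives
$P\equiv\varphi(-q)^5$ and $Z\equiv P^5$, so $\sum\overline a_5(2n)q^n$ is also a polynomial in
$X,Y,Z$ over $P$. Its parts with exponents 2 and 3 mod 5 are even functions of $q$ mod 5
(`cofactor_mul_eq_of_five_eq_zero`), so their coefficients at odd exponents vanish. -/

namespace PowerSeries

/-! ### Five-dissection, and the substitutions q ↦ -q and q ↦ q^p -/

variable {R : Type*} [CommRing R]

/-- The part of a power series supported on exponents congruent to `i` modulo `5`. -/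
noncomputable def part5 (i : ℕ) : R⟦X⟧ →ₗ[R] R⟦X⟧ where
  toFun f := mk fun n => if n % 5 = i then coeff n f else 0
  map_add' f g := by
    ext n
    simp only [coeff_mk, map_add]
    split_ifs <;> simp
  map_smul' r f := by
    ext n
    simp

theorem coeff_part5 (i n : ℕ) (f : R⟦X⟧) :
    coeff n (part5 i f) = if n % 5 = i then coeff n f else 0 := by
  simp [part5]

theorem part5_natCast_mul (i m : ℕ) (f : R⟦X⟧) :
    part5 i ((m : R⟦X⟧) * f) = (m : R⟦X⟧) * part5 i f := by
  rw [← nsmul_eq_mul, ← nsmul_eq_mul, map_nsmul]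

theorem part5_ofNat_mul (i m : ℕ) [m.AtLeastTwo] (f : R⟦X⟧) :
    part5 i ((ofNat(m) : R⟦X⟧) * f) = (ofNat(m) : R⟦X⟧) * part5 i f :=
  part5_natCast_mul i m f

theorem part5_part5_self (i : ℕ) (f : R⟦X⟧) : part5 i (part5 i f) = part5 i f := by
  ext n
  simp only [coeff_part5]
  split_ifs <;> rfl

theorem part5_part5_of_ne {i j : ℕ} (h : i ≠ j) (f : R⟦X⟧) : part5 i (part5 j f) = 0 := by
  ext n
  simp only [coeff_part5, map_zero]
  split_ifs with h1 h2
  · exact absurd (h1.symm.trans h2) h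
  · rfl
  · rfl

theorem coeff_part5_mul_aux {k : ℕ} (f g : R⟦X⟧) (p : ℕ → ℕ)
    (hp : ∀ a b, a % 5 < 5 → ((a + b) % 5 = k ↔ b % 5 = p (a % 5))) :
    part5 k (f * g) = ∑ i ∈ Finset.range 5, part5 i f * part5 (p i) g := by
  ext n
  rw [coeff_part5, map_sum]
  simp only [coeff_mul, coeff_part5]
  rw [Finset.sum_comm]
  split_ifs with h
  · refine Finset.sum_congr rfl fun x hx => ?_
    have hx' := Finset.HasAntidiagonal.mem_antidiagonal.1 hx
    have h5 : x.1 % 5 < 5 := Nat.mod_lt _ (by norm_num)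
    rw [Finset.sum_eq_single (x.1 % 5)]
    · have : x.2 % 5 = p (x.1 % 5) := (hp _ _ h5).1 (by rw [hx', h])
      simp [this]
    · intro b _ hb
      rw [if_neg (Ne.symm hb), zero_mul]
    · intro hb
      exact absurd (Finset.mem_range.2 h5) hb
  · symm
    refine Finset.sum_eq_zero fun x hx => Finset.sum_eq_zero fun i _ => ?_
    have hx' := Finset.HasAntidiagonal.mem_antidiagonal.1 hx
    have h5 : x.1 % 5 < 5 := Nat.mod_lt _ (by norm_num)
    by_cases h1 : x.1 % 5 = i
    · rw [if_neg (c := x.2 % 5 = p i), mul_zero]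
      intro h2
      rw [← h1, ← hp _ _ h5, hx'] at h2
      exact h h2
    · rw [if_neg h1, zero_mul]

theorem part5_mul (k : ℕ) (hk : k < 5) (f g : R⟦X⟧) :
    part5 k (f * g) = ∑ i ∈ Finset.range 5, part5 i f * part5 ((k + 5 - i) % 5) g :=
  coeff_part5_mul_aux f g (fun i => (k + 5 - i) % 5) (fun a b h => by omega)

theorem part5_zero_mul (f g : R⟦X⟧) : part5 0 (f * g) = part5 0 f * part5 0 g +
    part5 1 f * part5 4 g + part5 2 f * part5 3 g + part5 3 f * part5 2 g +
    part5 4 f * part5 1 g := by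
  simp [part5_mul 0 (by norm_num), Finset.sum_range_succ]

theorem part5_one_mul (f g : R⟦X⟧) : part5 1 (f * g) = part5 0 f * part5 1 g +
    part5 1 f * part5 0 g + part5 2 f * part5 4 g + part5 3 f * part5 3 g +
    part5 4 f * part5 2 g := by
  simp [part5_mul 1 (by norm_num), Finset.sum_range_succ]

theorem part5_two_mul (f g : R⟦X⟧) : part5 2 (f * g) = part5 0 f * part5 2 g +
    part5 1 f * part5 1 g + part5 2 f * part5 0 g + part5 3 f * part5 4 g +
    part5 4 f * part5 3 g := by
  simp [part5_mul 2 (by norm_num), Finset.sum_range_succ]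

theorem part5_three_mul (f g : R⟦X⟧) : part5 3 (f * g) = part5 0 f * part5 3 g +
    part5 1 f * part5 2 g + part5 2 f * part5 1 g + part5 3 f * part5 0 g +
    part5 4 f * part5 4 g := by
  simp [part5_mul 3 (by norm_num), Finset.sum_range_succ]

theorem part5_four_mul (f g : R⟦X⟧) : part5 4 (f * g) = part5 0 f * part5 4 g +
    part5 1 f * part5 3 g + part5 2 f * part5 2 g + part5 3 f * part5 1 g +
    part5 4 f * part5 0 g := by
  simp [part5_mul 4 (by norm_num), Finset.sum_range_succ]

theorem part5_zero_expand (f : R⟦X⟧) :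
    part5 0 (expand 5 (by decide) f) = expand 5 (by decide) f := by
  ext n
  rw [coeff_part5, coeff_expand]
  split_ifs <;> first | rfl | omega

theorem part5_expand_of_ne {i : ℕ} (hi : i ≠ 0) (f : R⟦X⟧) :
    part5 i (expand 5 (by decide) f) = 0 := by
  ext n
  rw [coeff_part5, coeff_expand, map_zero]
  split_ifs <;> first | rfl | omega

theorem part5_expand_two {i j : ℕ} (hi : i < 5) (hj : j < 5) (h : j = 2 * i % 5) (f : R⟦X⟧) :
    part5 j (expand 2 (by decide) f) = expand 2 (by decide) (part5 i f) := by
  ext n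
  rw [coeff_part5, coeff_expand, coeff_expand, coeff_part5]
  split_ifs <;> first | rfl | omega

theorem part5_evalNegHom (i : ℕ) (f : R⟦X⟧) :
    part5 i (evalNegHom f) = evalNegHom (part5 i f) := by
  ext n
  simp only [evalNegHom, coeff_part5, coeff_rescale]
  split_ifs <;> simp

theorem part5_map {S : Type*} [CommRing S] (h : R →+* S) (i : ℕ) (f : R⟦X⟧) :
    part5 i (map h f) = map h (part5 i f) := by
  ext n
  simp only [coeff_part5, coeff_map]
  split_ifs <;> simp

theorem sum_part5 (f : R⟦X⟧) :
    f = part5 0 f + part5 1 f + part5 2 f + part5 3 f + part5 4 f := by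
  ext n
  simp only [map_add, coeff_part5]
  have : n % 5 < 5 := Nat.mod_lt _ (by norm_num)
  interval_cases n % 5 <;> simp

theorem coeff_evalNegHom (f : R⟦X⟧) (n : ℕ) : coeff n (evalNegHom f) = (-1) ^ n * coeff n f := by
  rw [evalNegHom, coeff_rescale]

theorem evalNegHom_evalNegHom (f : R⟦X⟧) : evalNegHom (evalNegHom f) = f := by
  ext n
  rw [coeff_evalNegHom, coeff_evalNegHom, ← mul_assoc, ← mul_pow]
  simp

theorem evalNegHom_expand_of_odd {p : ℕ} (hp : p ≠ 0) (h : Odd p) (f : R⟦X⟧) :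
    evalNegHom (expand p hp f) = expand p hp (evalNegHom f) := by
  ext n
  rw [coeff_evalNegHom, coeff_expand, coeff_expand]
  split_ifs with hd
  · obtain ⟨m, rfl⟩ := hd
    rw [Nat.mul_div_cancel_left _ (Nat.pos_of_ne_zero hp), coeff_evalNegHom, pow_mul, h.neg_one_pow]
  · simp

theorem map_evalNegHom {S : Type*} [CommRing S] (h : R →+* S) (f : R⟦X⟧) :
    map h (evalNegHom f) = evalNegHom (map h f) := by
  ext n
  simp [coeff_evalNegHom]

theorem expand_injective {p : ℕ} (hp : p ≠ 0) :
    Function.Injective (expand p hp : R⟦X⟧ → R⟦X⟧) := by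
  intro f g h
  ext n
  rw [← coeff_expand_mul p hp f, h, coeff_expand_mul]

/-- Frobenius fixes the coefficients in the prime field, so $f(q^p)=f(q)^p$. -/
theorem expand_eq_pow (p : ℕ) [hp : Fact p.Prime] (f : (ZMod p)⟦X⟧) :
    expand p hp.out.ne_zero f = f ^ p := by
  have : ExpChar (ZMod p) p := ExpChar.prime hp.out
  have h := MvPowerSeries.map_frobenius_expand p hp.out.ne_zero (f := f)
  rw [ZMod.frobenius_zmod] at h
  rw [← h]
  exact (congrFun (map_id (R := ZMod p)) _).symm

end PowerSeries

open PowerSeries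

/-! ### Theta identities from counting points on circles -/

theorem neg_one_pow_natAbs (j : ℤ) : (-1 : ℤ) ^ j.natAbs = if Even j then 1 else -1 := by
  split_ifs with h
  · exact (Int.natAbs_even.2 h).neg_one_pow
  · exact (Int.natAbs_odd.2 (Int.not_even_iff_odd.1 h)).neg_one_pow

/-- The integer points on the circle `x ^ 2 + y ^ 2 = n`. -/
noncomputable def circlePoints (n : ℕ) : Finset (ℤ × ℤ) :=
  (Finset.Icc (-(n : ℤ)) n ×ˢ Finset.Icc (-(n : ℤ)) n).filter
    (fun p => p.1 ^ 2 + p.2 ^ 2 = (n : ℤ))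

theorem mem_circlePoints {n : ℕ} {p : ℤ × ℤ} :
    p ∈ circlePoints n ↔ p.1 ^ 2 + p.2 ^ 2 = (n : ℤ) := by
  unfold circlePoints
  rw [Finset.mem_filter, Finset.mem_product, Finset.mem_Icc, Finset.mem_Icc]
  refine ⟨fun h => h.2, fun h => ⟨?_, h⟩⟩
  have h1 := Int.le_self_sq p.1
  have h2 := Int.le_self_sq p.2
  have h3 := Int.le_self_sq (-p.1)
  have h4 := Int.le_self_sq (-p.2)
  rw [neg_sq] at h3 h4
  have h5 := sq_nonneg p.1
  have h6 := sq_nonneg p.2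
  refine ⟨⟨?_, ?_⟩, ?_, ?_⟩ <;> omega

/-- The theta series `∑ a(j) q ^ (j ^ 2)`. -/
noncomputable def thetaSeries (a : ℤ → ℤ) : ℤ⟦X⟧ := mk fun m => ∑ j ∈ intSqrts m, a j

theorem coeff_thetaSeries_mul (a b : ℤ → ℤ) (n : ℕ) :
    coeff n (thetaSeries a * thetaSeries b) = ∑ p ∈ circlePoints n, a p.1 * b p.2 := by
  rw [coeff_mul]
  simp only [thetaSeries, coeff_mk, Finset.sum_mul_sum]
  have hmaps : ∀ p ∈ circlePoints n, (p.1.natAbs ^ 2, p.2.natAbs ^ 2) ∈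
      Finset.HasAntidiagonal.antidiagonal n := by
    intro p hp
    rw [Finset.HasAntidiagonal.mem_antidiagonal]
    have := mem_circlePoints.1 hp
    zify
    simpa using this
  rw [← Finset.sum_fiberwise_of_maps_to hmaps]
  refine Finset.sum_congr rfl fun x hx => ?_
  rw [← Finset.sum_product']
  refine Finset.sum_congr ?_ fun _ _ => rfl
  ext p
  rw [Finset.mem_product, mem_intSqrts, mem_intSqrts, Finset.mem_filter, mem_circlePoints,
    Prod.ext_iff]
  have hx' := Finset.HasAntidiagonal.mem_antidiagonal.1 hx
  zify at hx' ⊢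
  simp only [sq_abs]
  constructor
  · rintro ⟨h1, h2⟩
    exact ⟨by rw [h1, h2, hx'], h1, h2⟩
  · exact fun h => h.2

theorem phiNeg_eq_thetaSeries : phiNeg = thetaSeries fun j => (-1 : ℤ) ^ j.natAbs := rfl

theorem evalNegHom_phiNeg : evalNegHom phiNeg = thetaSeries fun _ => 1 := by
  ext n
  rw [coeff_evalNegHom, phiNeg, thetaSeries, coeff_mk, coeff_mk, Finset.mul_sum]
  refine Finset.sum_congr rfl fun j hj => ?_
  have hn : n = j.natAbs ^ 2 := by
    zify
    rw [sq_abs, (mem_intSqrts n j).1 hj]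
  rw [← pow_add]
  refine Even.neg_one_pow ?_
  rw [hn, Nat.even_add, Nat.even_pow' two_ne_zero]

theorem coeff_phiNeg_sq (n : ℕ) : coeff n (phiNeg ^ 2) =
    ∑ p ∈ circlePoints n, (-1 : ℤ) ^ p.1.natAbs * (-1) ^ p.2.natAbs := by
  rw [sq, phiNeg_eq_thetaSeries, coeff_thetaSeries_mul]

/-- `φ(q) φ(-q) = φ(-q ^ 2) ^ 2`. -/
theorem phiNeg_mul_evalNegHom :
    phiNeg * evalNegHom phiNeg = expand 2 (by decide) (phiNeg ^ 2) := by
  ext n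
  rw [evalNegHom_phiNeg, phiNeg_eq_thetaSeries, coeff_thetaSeries_mul, coeff_expand,
    ← phiNeg_eq_thetaSeries]
  simp only [mul_one]
  split_ifs with h
  · obtain ⟨m, rfl⟩ := h
    rw [Nat.mul_div_cancel_left _ two_pos, coeff_phiNeg_sq]
    symm
    -- Multiplication by $1+i$ doubles the norm; it is onto because the coordinates of a point of
    -- even norm have equal parity.
    refine Finset.sum_bij' (fun p _ => (p.1 - p.2, p.1 + p.2))
      (fun p _ => ((p.1 + p.2) / 2, (p.2 - p.1) / 2)) ?_ ?_ ?_ ?_ ?_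
    · intro p hp
      rw [mem_circlePoints] at hp ⊢
      push_cast
      linear_combination 2 * hp
    · intro p hp
      rw [mem_circlePoints] at hp ⊢
      have he : Even (p.1 + p.2) := by
        have h1 : Even (p.1 ^ 2 + p.2 ^ 2) := by
          rw [hp]
          simp
        simpa [Int.even_add, Int.even_pow'] using h1
      obtain ⟨c, hc⟩ := he
      have h1 : (p.1 + p.2) / 2 = c := by omega
      have h2 : (p.2 - p.1) / 2 = c - p.1 := by omega
      dsimp only
      rw [h1, h2]
      have h3 : p.2 = c + c - p.1 := by omega
      rw [h3] at hp
      push_cast at hp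
      linarith
    · intro p _
      ext
      · dsimp only
        omega
      · dsimp only
        omega
    · intro p hp
      rw [mem_circlePoints] at hp
      have he : Even (p.1 + p.2) := by
        have h1 : Even (p.1 ^ 2 + p.2 ^ 2) := by
          rw [hp]
          simp
        simpa [Int.even_add, Int.even_pow'] using h1
      obtain ⟨c, hc⟩ := he
      ext
      · dsimp only
        omega
      · dsimp only
        omega
    · intro p _
      simp only [neg_one_pow_natAbs, Int.even_sub]
      by_cases h1 : Even p.1 <;> by_cases h2 : Even p.2 <;> simp [h1, h2]
  · have hswap : ∑ p ∈ circlePoints n, (-1 : ℤ) ^ p.1.natAbs =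
        ∑ p ∈ circlePoints n, (-1 : ℤ) ^ p.2.natAbs :=
      Finset.sum_bij' (fun p _ => p.swap) (fun p _ => p.swap)
        (fun p hp => by
          rw [mem_circlePoints] at hp ⊢
          simpa [add_comm] using hp)
        (fun p hp => by
          rw [mem_circlePoints] at hp ⊢
          simpa [add_comm] using hp)
        (fun _ _ => rfl) (fun _ _ => rfl) (fun _ _ => rfl)
    have hneg : ∑ p ∈ circlePoints n, (-1 : ℤ) ^ p.1.natAbs =
        -∑ p ∈ circlePoints n, (-1 : ℤ) ^ p.2.natAbs := by
      rw [← Finset.sum_neg_distrib]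
      refine Finset.sum_congr rfl fun p hp => ?_
      have ho : ¬ Even (p.1 ^ 2 + p.2 ^ 2) := by
        rw [mem_circlePoints.1 hp, Int.even_coe_nat, even_iff_two_dvd]
        exact h
      simp only [neg_one_pow_natAbs]
      by_cases h1 : Even p.1 <;> by_cases h2 : Even p.2 <;>
        simp [h1, h2, Int.even_add, Int.even_pow'] at ho ⊢
    linarith

/-- The bijection is multiplication by the Gaussian integer $2+i$ of norm 5, followed by conjugation
when $s=-1$. Its image is one of the two residue lines $x\equiv\pm 2y$ mod 5. -/
theorem sum_circlePoints_five_mul (w : ℤ → ℤ → ℤ) (n : ℕ) (s : ℤ) (hs : s ^ 2 = 1)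
    (hw : ∀ u v, w (2 * u - v) (s * (u + 2 * v)) = w u v) :
    ∑ p ∈ (circlePoints (5 * n)).filter (fun p => (5 : ℤ) ∣ p.1 - 2 * s * p.2), w p.1 p.2 =
      ∑ p ∈ circlePoints n, w p.1 p.2 := by
  symm
  have hs' : s = 1 ∨ s = -1 := by simpa using hs
  refine Finset.sum_bij' (fun p _ => (2 * p.1 - p.2, s * (p.1 + 2 * p.2)))
    (fun p _ => ((2 * p.1 + s * p.2) / 5, (2 * (s * p.2) - p.1) / 5)) ?_ ?_ ?_ ?_ ?_
  · intro p hp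
    rw [mem_circlePoints] at hp
    rw [Finset.mem_filter, mem_circlePoints]
    refine ⟨?_, -p.2, ?_⟩
    · push_cast
      linear_combination 5 * hp + (p.1 + 2 * p.2) ^ 2 * hs
    · linear_combination (-2 * (p.1 + 2 * p.2)) * hs
  · intro p hp
    rw [Finset.mem_filter, mem_circlePoints] at hp
    obtain ⟨hp, c, hc⟩ := hp
    rw [mem_circlePoints]
    rcases hs' with rfl | rfl
    · have h1 : (2 * p.1 + 1 * p.2) / 5 = p.2 + 2 * c := by omega
      have h2 : (2 * (1 * p.2) - p.1) / 5 = -c := by omega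
      dsimp only
      rw [h1, h2]
      have h3 : p.1 = 2 * p.2 + 5 * c := by omega
      rw [h3] at hp
      push_cast at hp
      linarith
    · have h1 : (2 * p.1 + -1 * p.2) / 5 = -p.2 + 2 * c := by omega
      have h2 : (2 * (-1 * p.2) - p.1) / 5 = -c := by omega
      dsimp only
      rw [h1, h2]
      have h3 : p.1 = -2 * p.2 + 5 * c := by omega
      rw [h3] at hp
      push_cast at hp
      linarith
  · intro p _
    rcases hs' with rfl | rfl <;> ext <;> dsimp only <;> omega
  · intro p hp
    rw [Finset.mem_filter] at hp
    obtain ⟨-, c, hc⟩ := hp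
    rcases hs' with rfl | rfl <;> ext <;> dsimp only <;> omega
  · intro p _
    exact (hw _ _).symm

/-- Modulo 5, $x^2+y^2=(x-2y)(x+2y)$, so the circle of norm $5n$ is the union of two lines' worth of
points, each a copy of the circle of norm $n$. The overlap consists of the points divisible by 5, a
copy of the circle of norm $n/5$; inclusion–exclusion finishes. -/
theorem coeff_five_mul_phiNeg_sq (n : ℕ) : coeff (5 * n) (phiNeg ^ 2) =
    2 * coeff n (phiNeg ^ 2) - if 5 ∣ n then coeff (n / 5) (phiNeg ^ 2) else 0 := by
  simp only [coeff_phiNeg_sq]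
  set w : ℤ → ℤ → ℤ := fun x y => (-1) ^ x.natAbs * (-1) ^ y.natAbs with hw
  have hplus := sum_circlePoints_five_mul w n 1 (by norm_num) fun u v => by
    simp only [hw, neg_one_pow_natAbs, Int.even_add, Int.even_sub, Int.even_mul]
    by_cases h1 : Even u <;> by_cases h2 : Even v <;> simp [h1, h2]
  have hminus := sum_circlePoints_five_mul w n (-1) (by norm_num) fun u v => by
    simp only [hw, neg_one_pow_natAbs, Int.even_add, Int.even_sub, Int.even_mul]
    by_cases h1 : Even u <;> by_cases h2 : Even v <;> simp [h1, h2]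
  have hunion : (circlePoints (5 * n)).filter (fun p => (5 : ℤ) ∣ p.1 - 2 * 1 * p.2) ∪
      (circlePoints (5 * n)).filter (fun p => (5 : ℤ) ∣ p.1 - 2 * (-1) * p.2) =
      circlePoints (5 * n) := by
    rw [← Finset.filter_or, Finset.filter_true_of_mem]
    intro p hp
    have h := mem_circlePoints.1 hp
    refine (Int.Prime.dvd_mul' (p := 5) (by norm_num) ?_)
    exact ⟨n - p.2 ^ 2, by push_cast at h ⊢; linear_combination h⟩
  have hinter : ∑ p ∈ (circlePoints (5 * n)).filter (fun p => (5 : ℤ) ∣ p.1 - 2 * 1 * p.2) ∩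
      (circlePoints (5 * n)).filter (fun p => (5 : ℤ) ∣ p.1 - 2 * (-1) * p.2), w p.1 p.2 =
      if 5 ∣ n then ∑ p ∈ circlePoints (n / 5), w p.1 p.2 else 0 := by
    rw [← Finset.filter_and]
    split_ifs with h5
    · obtain ⟨m, rfl⟩ := h5
      rw [Nat.mul_div_cancel_left _ (by norm_num)]
      symm
      refine Finset.sum_bij' (fun p _ => (5 * p.1, 5 * p.2)) (fun p _ => (p.1 / 5, p.2 / 5))
        ?_ ?_ ?_ ?_ ?_
      · intro p hp
        rw [mem_circlePoints] at hp
        rw [Finset.mem_filter, mem_circlePoints]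
        refine ⟨?_, by dsimp only; omega, by dsimp only; omega⟩
        push_cast
        linear_combination 25 * hp
      · intro p hp
        rw [Finset.mem_filter, mem_circlePoints] at hp
        obtain ⟨hp, h1, h2⟩ := hp
        have h3 : p.1 = 5 * (p.1 / 5) := by omega
        have h4 : p.2 = 5 * (p.2 / 5) := by omega
        rw [mem_circlePoints]
        dsimp only
        rw [h3, h4] at hp
        push_cast at hp
        linarith
      · intro p _
        ext <;> dsimp only <;> omega
      · intro p hp
        rw [Finset.mem_filter] at hp
        ext <;> dsimp only <;> omega
      · intro p _
        simp only [hw, neg_one_pow_natAbs, Int.even_mul]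
        have : ¬ Even (5 : ℤ) := by decide
        simp [this]
    · refine Finset.sum_eq_zero fun p hp => ?_
      exfalso
      rw [Finset.mem_filter, mem_circlePoints] at hp
      obtain ⟨hp, h1, h2⟩ := hp
      obtain ⟨c, hc⟩ : (5 : ℤ) ∣ p.1 := by omega
      obtain ⟨d, hd⟩ : (5 : ℤ) ∣ p.2 := by omega
      rw [hc, hd] at hp
      push_cast at hp
      have : (n : ℤ) = 5 * (c ^ 2 + d ^ 2) := by linarith
      omega
  have := Finset.sum_union_inter
    (s₁ := (circlePoints (5 * n)).filter (fun p => (5 : ℤ) ∣ p.1 - 2 * 1 * p.2))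
    (s₂ := (circlePoints (5 * n)).filter (fun p => (5 : ℤ) ∣ p.1 - 2 * (-1) * p.2))
    (f := fun p => w p.1 p.2)
  rw [hunion, hinter, hplus, hminus] at this
  linarith

/-- The Hecke relation `r₂(5n) = 2 r₂(n) - r₂(n / 5)` for sums of two squares. -/
theorem part5_zero_phiNeg_sq : part5 0 (phiNeg ^ 2) =
    2 * expand 5 (by decide) (phiNeg ^ 2) -
      expand 5 (by decide) (expand 5 (by decide) (phiNeg ^ 2)) := by
  ext n
  rw [coeff_part5, map_sub, two_mul, map_add, coeff_expand,
    coeff_expand]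
  by_cases h : 5 ∣ n
  · obtain ⟨m, rfl⟩ := h
    rw [if_pos (Nat.mul_mod_right 5 m), if_pos (Dvd.intro m rfl), if_pos (Dvd.intro m rfl),
      Nat.mul_div_cancel_left _ (by norm_num), coeff_five_mul_phiNeg_sq, coeff_expand]
    ring
  · rw [if_neg h, if_neg h, if_neg (by omega)]
    simp

theorem part5_phiNeg_eq_zero {i : ℕ} (h0 : i ≠ 0) (h1 : i ≠ 1) (h4 : i ≠ 4) :
    part5 i phiNeg = 0 := by
  ext n
  rw [coeff_part5, map_zero]
  split_ifs with h
  · rw [phiNeg, coeff_mk]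
    refine Finset.sum_eq_zero fun j hj => ?_
    exfalso
    have hj := (mem_intSqrts n j).1 hj
    have h5 : (n : ℤ) % 5 = i := by omega
    rw [← hj, sq, Int.mul_emod] at h5
    have : j % 5 = 0 ∨ j % 5 = 1 ∨ j % 5 = 2 ∨ j % 5 = 3 ∨ j % 5 = 4 := by omega
    rcases this with h | h | h | h | h <;> rw [h] at h5 <;> omega
  · rfl

theorem part5_zero_phiNeg :
    part5 0 phiNeg = expand 5 (by decide) (expand 5 (by decide) phiNeg) := by
  ext n
  rw [coeff_part5, ← expand_mul, coeff_expand, phiNeg, coeff_mk, coeff_mk]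
  split_ifs with h h25 h25
  · obtain ⟨m, rfl⟩ := h25
    rw [Nat.mul_div_cancel_left _ (by norm_num)]
    symm
    refine Finset.sum_bij' (fun j _ => 5 * j) (fun j _ => j / 5) ?_ ?_ ?_ ?_ ?_
    · intro j hj
      rw [mem_intSqrts] at hj ⊢
      push_cast
      linear_combination 25 * hj
    · intro j hj
      rw [mem_intSqrts] at hj ⊢
      obtain ⟨c, rfl⟩ : (5 : ℤ) ∣ j :=
        Int.Prime.dvd_pow' (p := 5) (n := j) (k := 2) (by norm_num)
          ⟨5 * m, by rw [hj]; push_cast; ring⟩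
      rw [Int.mul_ediv_cancel_left _ (by norm_num)]
      push_cast at hj
      linarith
    · intro j _
      omega
    · intro j hj
      rw [mem_intSqrts] at hj
      obtain ⟨c, rfl⟩ : (5 : ℤ) ∣ j :=
        Int.Prime.dvd_pow' (p := 5) (n := j) (k := 2) (by norm_num)
          ⟨5 * m, by rw [hj]; push_cast; ring⟩
      omega
    · intro j _
      have : ¬ Even (5 : ℤ) := by decide
      simp [neg_one_pow_natAbs, Int.even_mul, this]
  · refine Finset.sum_eq_zero fun j hj => ?_
    exfalso
    rw [mem_intSqrts] at hj
    obtain ⟨c, rfl⟩ : (5 : ℤ) ∣ j :=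
      Int.Prime.dvd_pow' (p := 5) (n := j) (k := 2) (by norm_num)
        ⟨n / 5, by rw [hj]; push_cast; omega⟩
    have : (n : ℤ) = 25 * c ^ 2 := by linarith
    omega
  · omega
  · rfl

/-! ### Algebraic consequences of the theta relations

In the application `a, z, x, y` are `φ(-q ^ 5)`, `φ(-q ^ 25)` and the parts of `φ(-q)` with
exponents `1` and `4` modulo `5`, while `b, w, s, t` are their images under `q ↦ -q`. -/

section Modular

variable {R : Type*} [CommRing R] [IsDomain R] {a z b w x y s t : R}

theorem add_ne_zero_of_sq_mul_sq (hx : x ≠ 0) (hs : s ≠ 0)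
    (h4 : x ^ 2 * s ^ 2 = 4 * z * w * (z * t + w * y)) :
    4 * z * w ≠ 0 ∧ z * t + w * y ≠ 0 := by
  have h : 4 * z * w * (z * t + w * y) ≠ 0 := by
    rw [← h4]
    exact mul_ne_zero (pow_ne_zero 2 hx) (pow_ne_zero 2 hs)
  exact ⟨left_ne_zero_of_mul h, right_ne_zero_of_mul h⟩

/-- Multiply `h4` by $x^2y^4$ in two ways: $x(zt+wy)$ is known from `h1` and `h2`, while $xy$ and
$sy$ are known from `h1` and `h3`. This eliminates $s$ and $t$. -/
theorem mul_pow_four_of_sq_mul_sq (hx : x ≠ 0) (hy : y ≠ 0) (h1 : x * y = a ^ 2 - z ^ 2)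
    (h2 : x * t = (a - z) * (b + w)) (h3 : s * y = (a + z) * (b - w))
    (h4 : x ^ 2 * s ^ 2 = 4 * z * w * (z * t + w * y)) :
    4 * z * w * (z * b + w * a + 2 * z * w) * (x * y ^ 4) =
      x ^ 2 * ((a ^ 2 - z ^ 2) * (a + z) ^ 3 * (b - w) ^ 2) := by
  have haz : a - z ≠ 0 := by
    intro h
    refine mul_ne_zero hx hy ?_
    rw [h1]
    linear_combination (a + z) * h
  have hM : x * (z * t + w * y) = (a - z) * (z * b + w * a + 2 * z * w) := by
    linear_combination z * h2 + w * h1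
  refine mul_left_cancel₀ haz ?_
  calc (a - z) * (4 * z * w * (z * b + w * a + 2 * z * w) * (x * y ^ 4))
      = 4 * z * w * (z * t + w * y) * (x ^ 2 * y ^ 4) := by
        linear_combination (-4 * z * w * x * y ^ 4) * hM
    _ = x ^ 2 * ((x * y) ^ 2 * (s * y) ^ 2) := by
        rw [← h4]
        ring
    _ = _ := by
        rw [h1, h3]
        ring

theorem pow_five_of_sq_mul_sq (hx : x ≠ 0) (hy : y ≠ 0) (h1 : x * y = a ^ 2 - z ^ 2)
    (h2 : x * t = (a - z) * (b + w)) (h3 : s * y = (a + z) * (b - w))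
    (h4 : x ^ 2 * s ^ 2 = 4 * z * w * (z * t + w * y)) :
    4 * z * w * (z * b + w * a + 2 * z * w) * y ^ 5 =
      (a + z) ^ 5 * (a - z) ^ 2 * (b - w) ^ 2 := by
  refine mul_left_cancel₀ (pow_ne_zero 2 hx) ?_
  have h := mul_pow_four_of_sq_mul_sq hx hy h1 h2 h3 h4
  calc x ^ 2 * (4 * z * w * (z * b + w * a + 2 * z * w) * y ^ 5)
      = x * y * (4 * z * w * (z * b + w * a + 2 * z * w) * (x * y ^ 4)) := by ring
    _ = _ := by
        rw [h, h1]
        ring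

theorem mul_pow_five_add_pow_five (hx : x ≠ 0) (hy : y ≠ 0) (hs : s ≠ 0) (ht : t ≠ 0)
    (h1 : x * y = a ^ 2 - z ^ 2)
    (h2 : x * t = (a - z) * (b + w)) (h3 : s * y = (a + z) * (b - w))
    (h4 : x ^ 2 * s ^ 2 = 4 * z * w * (z * t + w * y))
    (h5 : y ^ 2 * t ^ 2 = 4 * z * w * (z * s + w * x))
    (hK : (a ^ 2 - z ^ 2) * (b ^ 2 - w ^ 2) = 4 * z * w * (a * b - z * w)) :
    z * (x ^ 5 + y ^ 5) = (a ^ 2 - z ^ 2) * (a ^ 4 - 4 * a ^ 2 * z ^ 2 + 11 * z ^ 4) := by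
  have hy5 := pow_five_of_sq_mul_sq hx hy h1 h2 h3 h4
  -- The relations are invariant under $(z,w,x,y,s,t)\mapsto(-z,-w,-y,-x,-t,-s)$.
  have hx5 := pow_five_of_sq_mul_sq (a := a) (z := -z) (b := b) (w := -w) (x := -y) (y := -x)
    (s := -t) (t := -s) (neg_ne_zero.2 hy) (neg_ne_zero.2 hx) (by linear_combination h1)
    (by linear_combination h3) (by linear_combination h2) (by linear_combination h5)
  obtain ⟨hzw, hM⟩ := add_ne_zero_of_sq_mul_sq hx hs h4
  obtain ⟨-, hM'⟩ := add_ne_zero_of_sq_mul_sq hy ht h5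
  have hM2 : x * (z * t + w * y) = (a - z) * (z * b + w * a + 2 * z * w) := by
    linear_combination z * h2 + w * h1
  have hM3 : y * (z * s + w * x) = (a + z) * (z * b + w * a - 2 * z * w) := by
    linear_combination z * h3 + w * h1
  have hM0 : z * b + w * a + 2 * z * w ≠ 0 :=
    right_ne_zero_of_mul (hM2 ▸ mul_ne_zero hx hM)
  have hM0' : z * b + w * a - 2 * z * w ≠ 0 :=
    right_ne_zero_of_mul (hM3 ▸ mul_ne_zero hy hM')
  refine mul_left_cancel₀ (mul_ne_zero hzw (mul_ne_zero hM0 hM0')) ?_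
  -- With both denominators cleared, the fifth powers drop out and the remaining identity in
  -- $a,b,z,w$ is a multiple of `hK`.
  linear_combination z * (z * b + w * a + 2 * z * w) * hx5 +
    z * (z * b + w * a - 2 * z * w) * hy5 + z * (a ^ 2 - z ^ 2) *
      (2 * a ^ 4 * w + 2 * a ^ 3 * z * b - 14 * a ^ 2 * z ^ 2 * w + 6 * a * z ^ 3 * b + 36 * z ^
        4 * w) * hK

/-- This is the evenness of cofactor$/a$ under $q\mapsto -q$ in characteristic 5. The ratio
$s:x=(b-w):(a-z)$ removes $x$ and $s$, leaving `key`, an identity in $a,b,z,w$ alone. -/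
theorem cofactor_mul_eq_of_five_eq_zero (h5 : (5 : R) = 0) (hx : x ≠ 0) (hy : y ≠ 0)
    (hs : s ≠ 0) (ht : t ≠ 0) (hb : b ≠ 0) (hab : a ^ 5 * w = b ^ 5 * z)
    (h1 : x * y = a ^ 2 - z ^ 2) (h1' : s * t = b ^ 2 - w ^ 2)
    (h2 : x * t = (a - z) * (b + w)) (h3 : s * y = (a + z) * (b - w))
    (h4 : x ^ 2 * s ^ 2 = 4 * z * w * (z * t + w * y))
    (hK : (a ^ 2 - z ^ 2) * (b ^ 2 - w ^ 2) = 4 * z * w * (a * b - z * w)) :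
    x * (y ^ 4 - z ^ 3 * x + 2 * z * x ^ 2 * y) * b =
      s * (t ^ 4 - w ^ 3 * s + 2 * w * s ^ 2 * t) * a := by
  have hy4 := mul_pow_four_of_sq_mul_sq hx hy h1 h2 h3 h4
  have ht4 := mul_pow_four_of_sq_mul_sq (a := b) (z := w) (b := a) (w := z) (x := s) (y := t)
    (s := x) (t := y) hs ht h1' (by linear_combination h3) (by linear_combination h2)
    (by linear_combination h4)
  obtain ⟨hzw, hM⟩ := add_ne_zero_of_sq_mul_sq hx hs h4
  have hM2 : x * (z * t + w * y) = (a - z) * (z * b + w * a + 2 * z * w) := by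
    linear_combination z * h2 + w * h1
  have hM0 : z * b + w * a + 2 * z * w ≠ 0 :=
    right_ne_zero_of_mul (hM2 ▸ mul_ne_zero hx hM)
  have haz : a - z ≠ 0 := left_ne_zero_of_mul (hM2 ▸ mul_ne_zero hx hM)
  have hsx : s * (a - z) = x * (b - w) := by
    refine mul_left_cancel₀ hy ?_
    linear_combination (a - z) * h3 - (b - w) * h1
  have hz0 : z ≠ 0 := right_ne_zero_of_mul (left_ne_zero_of_mul hzw)
  have key : b * (a - z) ^ 2 * ((a ^ 2 - z ^ 2) * (a + z) ^ 3 * (b - w) ^ 2 +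
        4 * z ^ 2 * w * (z * b + w * a + 2 * z * w) * (2 * a ^ 2 - 3 * z ^ 2)) =
      a * (b - w) ^ 2 * ((b ^ 2 - w ^ 2) * (b + w) ^ 3 * (a - z) ^ 2 +
        4 * w ^ 2 * z * (w * a + z * b + 2 * w * z) * (2 * b ^ 2 - 3 * w ^ 2)) := by
    refine mul_right_cancel₀ (mul_ne_zero (pow_ne_zero 5 hb) hz0) ?_
    -- Weighting the two sides by the equal quantities $b^5z$ and $a^5w$ puts the difference in the
    -- ideal generated by `hK` and 5.
    have h : b * (a - z) ^ 2 * ((a ^ 2 - z ^ 2) * (a + z) ^ 3 * (b - w) ^ 2 +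
        4 * z ^ 2 * w * (z * b + w * a + 2 * z * w) * (2 * a ^ 2 - 3 * z ^ 2)) * (b ^ 5 * z) =
      a * (b - w) ^ 2 * ((b ^ 2 - w ^ 2) * (b + w) ^ 3 * (a - z) ^ 2 +
        4 * w ^ 2 * z * (w * a + z * b + 2 * w * z) * (2 * b ^ 2 - 3 * w ^ 2)) * (a ^ 5 * w) := by
      linear_combination (-a ^ 6 * b ^ 5 * w - a ^ 6 * b ^ 4 * w ^ 2 +
        2 * a ^ 6 * b ^ 3 * w ^ 3 + 2 * a ^ 6 * b ^ 2 * w ^ 4 - a ^ 6 * b * w ^ 5 -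
        a ^ 6 * w ^ 6 + a ^ 5 * z * b ^ 6 - a ^ 5 * z * b ^ 2 * w ^ 4 + a ^ 4 * z ^ 2 * b ^ 6 +
        2 * a ^ 4 * z ^ 2 * b ^ 3 * w ^ 3 - 2 * a ^ 3 * z ^ 3 * b ^ 6 -
        2 * a ^ 3 * z ^ 3 * b ^ 4 * w ^ 2 - 2 * a ^ 2 * z ^ 4 * b ^ 6 +
        a ^ 2 * z ^ 4 * b ^ 5 * w + a * z ^ 5 * b ^ 6 + z ^ 6 * b ^ 6) * hK +
        (-2 * a ^ 7 * z * b ^ 5 * w ^ 3 - a ^ 7 * z * b ^ 4 * w ^ 4 +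
        6 * a ^ 7 * z * b ^ 3 * w ^ 5 + a ^ 7 * z * b ^ 2 * w ^ 6 - 6 * a ^ 7 * z * b * w ^ 7 +
        2 * a ^ 7 * z * w ^ 8 + 2 * a ^ 6 * z ^ 2 * b ^ 4 * w ^ 4 +
        4 * a ^ 6 * z ^ 2 * b ^ 3 * w ^ 5 - 6 * a ^ 6 * z ^ 2 * b ^ 2 * w ^ 6 -
        6 * a ^ 6 * z ^ 2 * b * w ^ 7 + 6 * a ^ 6 * z ^ 2 * w ^ 8 +
        2 * a ^ 5 * z ^ 3 * b ^ 7 * w + a ^ 5 * z ^ 3 * b ^ 4 * w ^ 4 +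
        a ^ 5 * z ^ 3 * b ^ 2 * w ^ 6 + a ^ 4 * z ^ 4 * b ^ 7 * w -
        2 * a ^ 4 * z ^ 4 * b ^ 6 * w ^ 2 - a ^ 4 * z ^ 4 * b ^ 5 * w ^ 3 -
        2 * a ^ 4 * z ^ 4 * b ^ 3 * w ^ 5 - 6 * a ^ 3 * z ^ 5 * b ^ 7 * w -
        4 * a ^ 3 * z ^ 5 * b ^ 6 * w ^ 2 + 2 * a ^ 3 * z ^ 5 * b ^ 4 * w ^ 4 -
        a ^ 2 * z ^ 6 * b ^ 7 * w + 6 * a ^ 2 * z ^ 6 * b ^ 6 * w ^ 2 -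
        a ^ 2 * z ^ 6 * b ^ 5 * w ^ 3 + 6 * a * z ^ 7 * b ^ 7 * w +
        6 * a * z ^ 7 * b ^ 6 * w ^ 2 - 2 * z ^ 8 * b ^ 7 * w - 6 * z ^ 8 * b ^ 6 * w ^ 2) * h5
    rwa [hab] at h
  have hL : 4 * z * w * (z * b + w * a + 2 * z * w) *
      (x * (y ^ 4 - z ^ 3 * x + 2 * z * x ^ 2 * y)) =
      x ^ 2 * ((a ^ 2 - z ^ 2) * (a + z) ^ 3 * (b - w) ^ 2 +
        4 * z ^ 2 * w * (z * b + w * a + 2 * z * w) * (2 * a ^ 2 - 3 * z ^ 2)) := by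
    linear_combination hy4 +
      8 * z ^ 2 * w * (z * b + w * a + 2 * z * w) * x ^ 2 * h1
  have hL' : 4 * z * w * (z * b + w * a + 2 * z * w) *
      (s * (t ^ 4 - w ^ 3 * s + 2 * w * s ^ 2 * t)) =
      s ^ 2 * ((b ^ 2 - w ^ 2) * (b + w) ^ 3 * (a - z) ^ 2 +
        4 * w ^ 2 * z * (w * a + z * b + 2 * w * z) * (2 * b ^ 2 - 3 * w ^ 2)) := by
    linear_combination ht4 +
      8 * w ^ 2 * z * (z * b + w * a + 2 * z * w) * s ^ 2 * h1'
  refine mul_left_cancel₀ (mul_ne_zero (mul_ne_zero hzw hM0) (pow_ne_zero 2 haz)) ?_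
  have hsx2 : s ^ 2 * (a - z) ^ 2 = x ^ 2 * (b - w) ^ 2 := by
    rw [← mul_pow, hsx, mul_pow]
  linear_combination (a - z) ^ 2 * b * hL - (a - z) ^ 2 * a * hL' + x ^ 2 * key -
    a * ((b ^ 2 - w ^ 2) * (b + w) ^ 3 * (a - z) ^ 2 +
        4 * w ^ 2 * z * (w * a + z * b + 2 * w * z) * (2 * b ^ 2 - 3 * w ^ 2)) * hsx2

end Modular

/-! ### The 5-dissection of φ(-q) and the relations among its parts -/

namespace ThetaFive

/-- The theta function `φ(-q ^ 5)`. -/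
noncomputable def thetaP : ℤ⟦X⟧ := expand 5 (by decide) phiNeg

/-- The theta function `φ(-q ^ 25)`. -/
noncomputable def thetaZ : ℤ⟦X⟧ := expand 5 (by decide) thetaP

/-- The terms of `φ(-q)` with exponent `1` modulo `5`. -/
noncomputable def thetaX : ℤ⟦X⟧ := part5 1 phiNeg

/-- The terms of `φ(-q)` with exponent `4` modulo `5`. -/
noncomputable def thetaY : ℤ⟦X⟧ := part5 4 phiNeg

theorem part5_zero_phi : part5 0 phiNeg = thetaZ := part5_zero_phiNeg
theorem part5_one_phi : part5 1 phiNeg = thetaX := rfl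
theorem part5_two_phi : part5 2 phiNeg = 0 :=
  part5_phiNeg_eq_zero (by decide) (by decide) (by decide)
theorem part5_three_phi : part5 3 phiNeg = 0 :=
  part5_phiNeg_eq_zero (by decide) (by decide) (by decide)
theorem part5_four_phi : part5 4 phiNeg = thetaY := rfl

theorem part5_zero_thetaP : part5 0 thetaP = thetaP := part5_zero_expand _
theorem part5_thetaP {i : ℕ} (h : i ≠ 0) : part5 i thetaP = 0 := part5_expand_of_ne h _
theorem part5_zero_thetaZ : part5 0 thetaZ = thetaZ := part5_zero_expand _
theorem part5_thetaZ {i : ℕ} (h : i ≠ 0) : part5 i thetaZ = 0 := part5_expand_of_ne h _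
theorem part5_one_thetaX : part5 1 thetaX = thetaX := part5_part5_self _ _
theorem part5_thetaX {i : ℕ} (h : i ≠ 1) : part5 i thetaX = 0 := part5_part5_of_ne h _
theorem part5_four_thetaY : part5 4 thetaY = thetaY := part5_part5_self _ _
theorem part5_thetaY {i : ℕ} (h : i ≠ 4) : part5 i thetaY = 0 := part5_part5_of_ne h _

theorem phiNeg_eq_add : phiNeg = thetaZ + thetaX + thetaY := by
  conv_lhs => rw [sum_part5 phiNeg]
  rw [part5_zero_phi, part5_one_phi, part5_two_phi, part5_three_phi, part5_four_phi]
  ring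

/-- The part of $\varphi(-q)^2$ with exponents divisible by 5 is $Z^2+2XY$, and the Hecke relation
says it equals $2P^2-Z^2$. -/
theorem thetaX_mul_thetaY : thetaX * thetaY = thetaP ^ 2 - thetaZ ^ 2 := by
  have h := part5_zero_phiNeg_sq
  rw [sq phiNeg, part5_zero_mul] at h
  simp only [part5_zero_phi, part5_one_phi, part5_two_phi, part5_three_phi, part5_four_phi,
    map_mul] at h
  change _ = 2 * (thetaP * thetaP) - thetaZ * thetaZ at h
  have h2 : (2 : ℤ⟦X⟧) ≠ 0 := fun h => by
    have h0 := congrArg constantCoeff h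
    rw [map_ofNat, map_zero] at h0
    exact two_ne_zero h0
  refine mul_left_cancel₀ h2 ?_
  linear_combination h

theorem thetaP_mul_neg : thetaP * evalNegHom thetaP = expand 2 (by decide) thetaP ^ 2 := by
  rw [thetaP, evalNegHom_expand_of_odd _ (by decide), ← map_mul, phiNeg_mul_evalNegHom,
    ← expand_mul, map_pow, ← expand_mul]

theorem thetaZ_mul_neg : thetaZ * evalNegHom thetaZ = expand 2 (by decide) thetaZ ^ 2 := by
  rw [thetaZ, evalNegHom_expand_of_odd _ (by decide), ← map_mul, thetaP_mul_neg, map_pow,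
    ← expand_mul, ← expand_mul]

theorem thetaZ_mul_neg_thetaX_add : thetaZ * evalNegHom thetaX + evalNegHom thetaZ * thetaX =
    expand 2 (by decide) thetaY ^ 2 := by
  have h := congrArg (part5 1) phiNeg_mul_evalNegHom
  rw [part5_expand_two (i := 3) (by decide) (by decide) (by decide), sq, part5_one_mul,
    part5_three_mul] at h
  simp only [part5_evalNegHom, part5_zero_phi, part5_one_phi, part5_two_phi, part5_three_phi,
    part5_four_phi, map_mul, map_add, map_zero] at h
  linear_combination h

theorem thetaZ_mul_neg_thetaY_add : thetaZ * evalNegHom thetaY + evalNegHom thetaZ * thetaY =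
    expand 2 (by decide) thetaX ^ 2 := by
  have h := congrArg (part5 4) phiNeg_mul_evalNegHom
  rw [part5_expand_two (i := 2) (by decide) (by decide) (by decide), sq, part5_four_mul,
    part5_two_mul] at h
  simp only [part5_evalNegHom, part5_zero_phi, part5_one_phi, part5_two_phi, part5_three_phi,
    part5_four_phi, map_mul, map_add, map_zero] at h
  linear_combination h

theorem thetaX_mul_neg : thetaX * evalNegHom thetaX =
    2 * expand 2 (by decide) thetaZ * expand 2 (by decide) thetaX := by
  have h := congrArg (part5 2) phiNeg_mul_evalNegHom
  rw [part5_expand_two (i := 1) (by decide) (by decide) (by decide), sq, part5_two_mul,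
    part5_one_mul] at h
  simp only [part5_evalNegHom, part5_zero_phi, part5_one_phi, part5_two_phi, part5_three_phi,
    part5_four_phi, map_mul, map_add, map_zero] at h
  linear_combination h

theorem thetaY_mul_neg : thetaY * evalNegHom thetaY =
    2 * expand 2 (by decide) thetaZ * expand 2 (by decide) thetaY := by
  have h := congrArg (part5 3) phiNeg_mul_evalNegHom
  rw [part5_expand_two (i := 4) (by decide) (by decide) (by decide), sq, part5_three_mul,
    part5_four_mul] at h
  simp only [part5_evalNegHom, part5_zero_phi, part5_one_phi, part5_two_phi, part5_three_phi,
    part5_four_phi, map_mul, map_add, map_zero] at h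
  linear_combination h

theorem thetaX_mul_neg_thetaY_add : thetaX * evalNegHom thetaY + evalNegHom thetaX * thetaY =
    2 * (thetaP * evalNegHom thetaP - thetaZ * evalNegHom thetaZ) := by
  have h := congrArg (part5 0) phiNeg_mul_evalNegHom
  rw [part5_expand_two (i := 0) (by decide) (by decide) (by decide), sq, part5_zero_mul,
    part5_zero_mul] at h
  simp only [part5_evalNegHom, part5_zero_phi, part5_one_phi, part5_two_phi, part5_three_phi,
    part5_four_phi, map_mul, map_add, map_zero] at h
  have h2 := congrArg (expand 2 (by decide)) thetaX_mul_thetaY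
  simp only [map_mul, map_sub, map_pow] at h2
  linear_combination h + 2 * h2 - 2 * thetaP_mul_neg + thetaZ_mul_neg

theorem neg_thetaX_mul_neg_thetaY : evalNegHom thetaX * evalNegHom thetaY =
    evalNegHom thetaP ^ 2 - evalNegHom thetaZ ^ 2 := by
  simpa using congrArg evalNegHom thetaX_mul_thetaY

theorem sq_thetaX_mul_sq_neg : thetaX ^ 2 * evalNegHom thetaX ^ 2 =
    4 * thetaZ * evalNegHom thetaZ *
      (thetaZ * evalNegHom thetaY + evalNegHom thetaZ * thetaY) := by
  rw [thetaZ_mul_neg_thetaY_add, ← mul_pow, thetaX_mul_neg, mul_assoc 4, thetaZ_mul_neg]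
  ring

theorem sq_thetaY_mul_sq_neg : thetaY ^ 2 * evalNegHom thetaY ^ 2 =
    4 * thetaZ * evalNegHom thetaZ *
      (thetaZ * evalNegHom thetaX + evalNegHom thetaZ * thetaX) := by
  rw [thetaZ_mul_neg_thetaX_add, ← mul_pow, thetaY_mul_neg, mul_assoc 4, thetaZ_mul_neg]
  ring

/-- Evaluate $X(q)Y(q)X(-q)Y(-q)$ by pairing $X$ with $Y$, and by pairing each series with its image
under $q\mapsto -q$. -/
theorem sq_sub_sq_mul_neg :
    (thetaP ^ 2 - thetaZ ^ 2) * (evalNegHom thetaP ^ 2 - evalNegHom thetaZ ^ 2) =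
      4 * thetaZ * evalNegHom thetaZ *
        (thetaP * evalNegHom thetaP - thetaZ * evalNegHom thetaZ) := by
  have h2 := congrArg (expand 2 (by decide)) thetaX_mul_thetaY
  simp only [map_mul, map_sub, map_pow] at h2
  rw [← thetaX_mul_thetaY, ← neg_thetaX_mul_neg_thetaY, mul_assoc 4, thetaZ_mul_neg,
    thetaP_mul_neg, ← h2, mul_mul_mul_comm, thetaX_mul_neg, thetaY_mul_neg]
  ring

theorem coeff_phiNeg_zero : coeff 0 phiNeg = 1 := by
  rw [phiNeg, coeff_mk]
  decide

theorem coeff_phiNeg_one : coeff 1 phiNeg = -2 := by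
  rw [phiNeg, coeff_mk]
  decide

theorem coeff_phiNeg_four : coeff 4 phiNeg = 2 := by
  rw [phiNeg, coeff_mk]
  decide

theorem coeff_thetaX_one : coeff 1 thetaX = -2 := by
  rw [thetaX, coeff_part5, if_pos (by decide), coeff_phiNeg_one]

theorem coeff_thetaY_four : coeff 4 thetaY = 2 := by
  rw [thetaY, coeff_part5, if_pos (by decide), coeff_phiNeg_four]

/-- $X(q)Y(-q)$ and $X(-q)Y(q)$ have the same sum and product as $(P(q)-Z(q))(P(-q)+Z(-q))$ and
$(P(q)+Z(q))(P(-q)-Z(-q))$, so the pairs agree up to order. The coefficient of $q^5$, which is $-4$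
against $4$, decides the order. -/
theorem thetaX_mul_neg_thetaY : thetaX * evalNegHom thetaY =
    (thetaP - thetaZ) * (evalNegHom thetaP + evalNegHom thetaZ) := by
  have h : (thetaX * evalNegHom thetaY -
        (thetaP - thetaZ) * (evalNegHom thetaP + evalNegHom thetaZ)) *
      (thetaX * evalNegHom thetaY -
        (thetaP + thetaZ) * (evalNegHom thetaP - evalNegHom thetaZ)) = 0 := by
    linear_combination (thetaX * evalNegHom thetaY) * thetaX_mul_neg_thetaY_add -
      evalNegHom thetaX * evalNegHom thetaY * thetaX_mul_thetaY -
      (thetaP ^ 2 - thetaZ ^ 2) * neg_thetaX_mul_neg_thetaY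
  refine sub_eq_zero.1 ((mul_eq_zero.1 h).resolve_right fun h => ?_)
  have h5 := congrArg (coeff 5) h
  have hX : ∀ n, n % 5 ≠ 1 → coeff n thetaX = 0 := fun n hn => by
    rw [thetaX, coeff_part5, if_neg hn]
  have hZ : ∀ n, ¬ 25 ∣ n → coeff n thetaZ = 0 := fun n hn => by
    rw [thetaZ, thetaP, ← expand_mul, coeff_expand, if_neg hn]
  have hP : ∀ n, ¬ 5 ∣ n → coeff n thetaP = 0 := fun n hn => by
    rw [thetaP, coeff_expand, if_neg hn]
  have hP0 : coeff 0 thetaP = 1 := by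
    rw [thetaP, coeff_expand, if_pos (by decide), Nat.zero_div, coeff_phiNeg_zero]
  have hP5 : coeff 5 thetaP = -2 := by
    rw [thetaP, coeff_expand, if_pos (by decide), Nat.div_self (by decide), coeff_phiNeg_one]
  have hZ0 : coeff 0 thetaZ = 1 := by
    rw [thetaZ, coeff_expand, if_pos (by decide), Nat.zero_div, hP0]
  rw [map_sub, coeff_mul, coeff_mul, Finset.Nat.sum_antidiagonal_eq_sum_range_succ_mk,
    Finset.Nat.sum_antidiagonal_eq_sum_range_succ_mk] at h5
  simp only [Finset.sum_range_succ, Finset.sum_range_zero, map_add, map_sub, coeff_evalNegHom] at h5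
  simp [hX, hZ 5 (by decide), coeff_thetaX_one, coeff_thetaY_four, hP 1 (by decide),
    hP 2 (by decide), hP 3 (by decide), hP 4 (by decide), hZ 1 (by decide), hZ 2 (by decide),
    hZ 3 (by decide), hZ 4 (by decide), hP0, hP5, hZ0] at h5

theorem neg_thetaX_mul_thetaY : evalNegHom thetaX * thetaY =
    (thetaP + thetaZ) * (evalNegHom thetaP - evalNegHom thetaZ) := by
  linear_combination thetaX_mul_neg_thetaY_add - thetaX_mul_neg_thetaY

theorem thetaX_ne_zero : thetaX ≠ 0 := fun h => by
  simpa [h] using coeff_thetaX_one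

theorem thetaY_ne_zero : thetaY ≠ 0 := fun h => by
  simpa [h] using coeff_thetaY_four

theorem evalNegHom_ne_zero {R : Type*} [CommRing R] {f : R⟦X⟧} (h : f ≠ 0) :
    evalNegHom f ≠ 0 := fun h0 => h <| by
  rw [← evalNegHom_evalNegHom f, h0, map_zero]

theorem thetaZ_mul_pow_five_add : thetaZ * (thetaX ^ 5 + thetaY ^ 5) =
    (thetaP ^ 2 - thetaZ ^ 2) *
      (thetaP ^ 4 - 4 * thetaP ^ 2 * thetaZ ^ 2 + 11 * thetaZ ^ 4) :=
  mul_pow_five_add_pow_five thetaX_ne_zero thetaY_ne_zero (evalNegHom_ne_zero thetaX_ne_zero)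
    (evalNegHom_ne_zero thetaY_ne_zero) thetaX_mul_thetaY thetaX_mul_neg_thetaY
    neg_thetaX_mul_thetaY sq_thetaX_mul_sq_neg sq_thetaY_mul_sq_neg sq_sub_sq_mul_neg

/-! ### The recurrence along powers of 5 -/

/-- The generating function `φ(-q ^ 5) ^ 5 / φ(-q)` of `abar5`. -/
noncomputable def genFun : ℤ⟦X⟧ := abarSeries 5 (by decide)

theorem coeff_genFun (n : ℕ) : coeff n genFun = abar5 n := rfl

theorem genFun_mul_phiNeg : genFun * phiNeg = thetaP ^ 5 := abarSeries_mul_phiNeg 5 (by decide)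

theorem phiNeg_ne_zero : phiNeg ≠ 0 := fun h => by
  simpa [h] using coeff_phiNeg_zero

theorem thetaP_ne_zero : thetaP ≠ 0 := fun h =>
  phiNeg_ne_zero (expand_injective (p := 5) (by decide) (by rw [← thetaP, h, map_zero]))

/-- The series `∑ abar5 (5 n) q ^ n`. -/
noncomputable def genFunFive : ℤ⟦X⟧ := mk fun n => abar5 (5 * n)

theorem part5_zero_eq_expand (f : ℤ⟦X⟧) :
    part5 0 f = expand 5 (by decide) (mk fun n => coeff (5 * n) f) := by
  ext n
  rw [coeff_part5, coeff_expand]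
  split_ifs with h h5 h5
  · obtain ⟨m, rfl⟩ := h5
    rw [Nat.mul_div_cancel_left _ (by norm_num), coeff_mk]
  · omega
  · omega
  · rfl

/-- The bracket is $\prod_{\zeta\ne 1}(Z+\zeta X+\zeta^{-1}Y)$ over fifth roots of unity, grouped by
exponents 0, 1, 4, 2, 3 mod 5. Times $Z\varphi(-q)$ it is $P^6$. -/
theorem genFun_mul_thetaP : genFun * thetaP = thetaZ *
    ((thetaZ ^ 4 - 3 * thetaZ ^ 2 * (thetaX * thetaY) + (thetaX * thetaY) ^ 2) +
      (thetaY ^ 4 - thetaZ ^ 3 * thetaX + 2 * thetaZ * (thetaX * thetaY) * thetaX) +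
      (thetaX ^ 4 - thetaZ ^ 3 * thetaY + 2 * thetaZ * (thetaX * thetaY) * thetaY) +
      (thetaZ ^ 2 * thetaX ^ 2 - thetaZ * thetaY ^ 3 - (thetaX * thetaY) * thetaX ^ 2) +
      (thetaZ ^ 2 * thetaY ^ 2 - thetaZ * thetaX ^ 3 - (thetaX * thetaY) * thetaY ^ 2)) := by
  refine mul_right_cancel₀ phiNeg_ne_zero ?_
  rw [mul_right_comm, genFun_mul_phiNeg, phiNeg_eq_add]
  linear_combination -thetaZ_mul_pow_five_add + (5 * thetaZ ^ 4 -
    5 * thetaZ ^ 2 * (thetaX * thetaY + thetaP ^ 2 - thetaZ ^ 2)) * thetaX_mul_thetaY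

theorem expand_genFunFive_mul_thetaP : expand 5 (by decide) genFunFive * thetaP =
    thetaZ * (5 * thetaZ ^ 4 - 5 * thetaZ ^ 2 * thetaP ^ 2 + thetaP ^ 4) := by
  have h := congrArg (part5 0) genFun_mul_thetaP
  rw [part5_zero_mul, part5_zero_eq_expand genFun] at h
  simp only [pow_succ, pow_zero, one_mul, mul_assoc, part5_zero_mul, part5_one_mul, part5_two_mul,
    part5_three_mul, part5_four_mul, map_add, map_sub, part5_ofNat_mul, part5_zero_thetaP,
    part5_zero_thetaZ, part5_one_thetaX, part5_four_thetaY, part5_thetaP, part5_thetaZ,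
    part5_thetaX, part5_thetaY, ne_eq, OfNat.ofNat_ne_zero, OfNat.zero_ne_ofNat, one_ne_zero,
    zero_ne_one, OfNat.one_ne_ofNat, OfNat.ofNat_ne_one, not_false_eq_true, mul_zero, zero_mul,
    add_zero, zero_add, Nat.reduceEqDiff, sub_zero] at h
  change expand 5 _ genFunFive * thetaP = _ at h
  linear_combination h + (-3 * thetaZ ^ 3 + thetaZ * (thetaX * thetaY + thetaP ^ 2 - thetaZ ^ 2)) *
    thetaX_mul_thetaY

theorem genFunFive_eq :
    genFunFive = 5 * genFun + thetaP * phiNeg ^ 3 - 5 * (thetaP ^ 3 * phiNeg) := by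
  have h : genFunFive * phiNeg =
      thetaP * (5 * thetaP ^ 4 - 5 * thetaP ^ 2 * phiNeg ^ 2 + phiNeg ^ 4) := by
    -- The dissection only involves series in $q^5$; replacing $q^5$ by $q$ turns $P,Z$ into
    -- $\varphi(-q),P$.
    refine expand_injective (p := 5) (by decide) ?_
    have h5 : expand 5 (by decide) (5 : ℤ⟦X⟧) = 5 := map_ofNat _ 5
    simp only [map_mul, map_add, map_sub, map_pow, h5]
    exact expand_genFunFive_mul_thetaP
  refine mul_right_cancel₀ phiNeg_ne_zero ?_
  linear_combination h - 5 * genFun_mul_phiNeg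

theorem part5_zero_genFunFive :
    part5 0 genFunFive = 6 * part5 0 genFun - 5 * expand 5 (by decide) genFun := by
  have h := congrArg (part5 0) genFunFive_eq
  simp only [pow_succ, pow_zero, one_mul, mul_assoc, part5_zero_mul, part5_one_mul, part5_two_mul,
    part5_three_mul, part5_four_mul, map_add, map_sub, part5_ofNat_mul, part5_zero_thetaP,
    part5_thetaP, part5_zero_phi, part5_one_phi, part5_two_phi, part5_three_phi, part5_four_phi,
    ne_eq, OfNat.ofNat_ne_zero, one_ne_zero,
    not_false_eq_true, mul_zero, zero_mul, add_zero, zero_add] at h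
  have hf : expand 5 (by decide) genFun * thetaP = thetaZ ^ 5 := by
    rw [thetaP, ← map_mul, genFun_mul_phiNeg, map_pow, ← thetaZ]
  have hg : part5 0 genFun * thetaP =
      thetaZ * (5 * thetaZ ^ 4 - 5 * thetaZ ^ 2 * thetaP ^ 2 + thetaP ^ 4) := by
    rw [part5_zero_eq_expand]
    exact expand_genFunFive_mul_thetaP
  refine mul_right_cancel₀ thetaP_ne_zero ?_
  linear_combination thetaP * h + 5 * hf - hg + 6 * thetaP ^ 2 * thetaZ * thetaX_mul_thetaY

theorem abar5_recurrence (n : ℕ) :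
    abar5 (5 * (5 * n)) = 6 * abar5 (5 * n) - 5 * abar5 n := by
  have h := congrArg (coeff (5 * n)) part5_zero_genFunFive
  have h6 : (6 : ℤ⟦X⟧) = C 6 := (map_ofNat C 6).symm
  have h5 : (5 : ℤ⟦X⟧) = C 5 := (map_ofNat C 5).symm
  rw [h6, h5, map_sub, coeff_C_mul, coeff_C_mul, coeff_part5, coeff_part5,
    if_pos (Nat.mul_mod_right 5 n), if_pos (Nat.mul_mod_right 5 n), coeff_expand_mul] at h
  simpa [genFunFive, coeff_genFun] using h

/-- Closed form of the recurrence $u_{k+2}=6u_{k+1}-5u_k$, with characteristic roots 1 and 5. -/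
theorem four_mul_abar5_five_pow (n k : ℕ) : 4 * abar5 (5 ^ k * n) =
    5 * abar5 n - abar5 (5 * n) + 5 ^ k * (abar5 (5 * n) - abar5 n) := by
  induction k using Nat.strong_induction_on with
  | _ k ih =>
    match k, ih with
    | 0, _ =>
      rw [pow_zero, one_mul]
      ring
    | 1, _ =>
      rw [pow_one]
      ring
    | k + 2, ih =>
      have h0 := ih k (by omega)
      have h1 := ih (k + 1) (by omega)
      have h := abar5_recurrence (5 ^ k * n)
      rw [show 5 ^ (k + 2) * n = 5 * (5 * (5 ^ k * n)) by ring]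
      rw [show 5 ^ (k + 1) * n = 5 * (5 ^ k * n) by ring] at h1
      linear_combination 4 * h + 6 * h1 - 5 * h0

/-! ### Divisibility by 2 -/

theorem two_dvd_abar5 {n : ℕ} (hn : n ≠ 0) : (2 : ℤ) ∣ abar5 n := by
  have hphi : map (Int.castRingHom (ZMod 2)) phiNeg = 1 := by
    ext m
    rw [coeff_map, coeff_one, phiNeg, coeff_mk]
    split_ifs with h
    · rw [h]
      decide
    · rw [eq_intCast, Int.cast_sum]
      have : ∀ j ∈ intSqrts m, (((-1 : ℤ) ^ j.natAbs : ℤ) : ZMod 2) = 1 := fun j _ => by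
        rw [neg_one_pow_natAbs]
        split_ifs <;> decide
      rw [Finset.sum_congr rfl this]
      -- The roots $j$ and $-j$ cancel mod 2; a fixed point would force $m=0$.
      refine Finset.sum_involution (fun j _ => -j) ?_ ?_ ?_ ?_
      · intro _ _
        decide
      · intro j hj _ hneg
        rw [mem_intSqrts] at hj
        have : j = 0 := by omega
        rw [this] at hj
        simp at hj
        omega
      · intro j hj
        rw [mem_intSqrts] at hj ⊢
        rwa [neg_sq]
      · intro j _
        exact neg_neg j
  have h := congrArg (map (Int.castRingHom (ZMod 2))) genFun_mul_phiNeg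
  rw [map_mul, hphi, mul_one, map_pow, thetaP, map_expand, hphi, map_one, one_pow] at h
  have hc := congrArg (coeff n) h
  rw [coeff_map, coeff_one, if_neg hn, coeff_genFun, eq_intCast] at hc
  exact_mod_cast (ZMod.intCast_zmod_eq_zero_iff_dvd _ 2).1 hc

/-! ### Divisibility by 5 along even arguments -/

/-- The series `∑ abar5 (2 n) q ^ n`. -/
noncomputable def genFunTwo : ℤ⟦X⟧ := mk fun n => abar5 (2 * n)

theorem genFun_add_neg :
    genFun + evalNegHom genFun = expand 2 (by decide) (2 * genFunTwo) := by
  ext n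
  rw [map_add, coeff_evalNegHom, coeff_expand, coeff_genFun]
  split_ifs with h
  · obtain ⟨m, rfl⟩ := h
    rw [Nat.mul_div_cancel_left _ two_pos, pow_mul, two_mul genFunTwo, map_add, genFunTwo, coeff_mk]
    simp
  · have hn : Odd n := Nat.not_even_iff_odd.1 fun he => h he.two_dvd
    rw [hn.neg_one_pow]
    ring

theorem thetaZ_mul_neg_phiNeg_add : thetaZ * evalNegHom phiNeg + evalNegHom thetaZ * phiNeg =
    expand 2 (by decide) (2 * thetaZ ^ 2 + thetaX ^ 2 + thetaY ^ 2) := by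
  rw [phiNeg_eq_add]
  have h2 : expand 2 (by decide) (2 : ℤ⟦X⟧) = 2 := map_ofNat _ 2
  simp only [map_add, map_mul, map_pow, h2]
  linear_combination 2 * thetaZ_mul_neg + thetaZ_mul_neg_thetaX_add + thetaZ_mul_neg_thetaY_add

/-- Reduction of the coefficients modulo `5`. -/
noncomputable abbrev red : ℤ⟦X⟧ →+* (ZMod 5)⟦X⟧ := map (Int.castRingHom (ZMod 5))

theorem five_eq_zero : (5 : (ZMod 5)⟦X⟧) = 0 := by
  rw [← map_ofNat (C (R := ZMod 5)) 5, show (OfNat.ofNat 5 : ZMod 5) = 0 from rfl, map_zero]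

theorem red_expand (f : ℤ⟦X⟧) : red (expand 5 (by decide) f) = red f ^ 5 := by
  have : Fact (Nat.Prime 5) := ⟨by decide⟩
  rw [red, map_expand, expand_eq_pow 5]

theorem red_thetaP : red thetaP = red phiNeg ^ 5 := red_expand _

theorem red_thetaZ : red thetaZ = red thetaP ^ 5 := red_expand _

theorem red_neg_thetaZ : red (evalNegHom thetaZ) = red (evalNegHom thetaP) ^ 5 := by
  rw [red, map_evalNegHom, ← red, red_thetaZ, map_pow, ← map_evalNegHom]

/-- Multiplying $g(q)+g(-q)$, with $g=P^5/\varphi(-q)$, by $\varphi(q)\varphi(-q)=\varphi(-q^2)^2$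
clears denominators, and $P^5\equiv Z$ gives $2\varphi(-q)^2\sum\overline a_5(2n)q^n$. A further
factor $\varphi(-q)^3$ makes the multiplier $\varphi(-q)^5\equiv P$, a series in $q^5$, so the
dissection passes through it. -/
theorem red_genFunTwo_mul_thetaP : red (2 * genFunTwo * thetaP) =
    red ((2 * thetaZ ^ 2 + thetaX ^ 2 + thetaY ^ 2) * (thetaZ + thetaX + thetaY) ^ 3) := by
  have h : red (2 * genFunTwo * phiNeg ^ 2) = red (2 * thetaZ ^ 2 + thetaX ^ 2 + thetaY ^ 2) := by
    refine expand_injective (p := 2) (by decide) ?_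
    rw [← map_expand, ← map_expand, ← thetaZ_mul_neg_phiNeg_add, map_mul (expand 2 _),
      ← phiNeg_mul_evalNegHom, ← genFun_add_neg]
    have hg : evalNegHom genFun * evalNegHom phiNeg = evalNegHom thetaP ^ 5 := by
      simpa using congrArg evalNegHom genFun_mul_phiNeg
    rw [show (genFun + evalNegHom genFun) * (phiNeg * evalNegHom phiNeg) =
        thetaP ^ 5 * evalNegHom phiNeg + evalNegHom thetaP ^ 5 * phiNeg by
      linear_combination evalNegHom phiNeg * genFun_mul_phiNeg + phiNeg * hg]
    change red _ = red _
    simp only [map_add, map_mul, map_pow, red_thetaZ, red_neg_thetaZ]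
  rw [← phiNeg_eq_add, map_mul red (_ + _), ← h, map_mul, red_thetaP, map_mul, map_mul,
    map_mul, map_pow, map_pow]
  ring

theorem red_part5_two_genFunTwo_mul : red (part5 2 genFunTwo) * red thetaP =
    -(red thetaX * (red thetaY ^ 4 - red thetaZ ^ 3 * red thetaX +
      2 * red thetaZ * red thetaX ^ 2 * red thetaY)) := by
  have h := congrArg (part5 2) red_genFunTwo_mul_thetaP
  rw [red, part5_map, part5_map] at h
  simp only [pow_succ, pow_zero, one_mul, mul_assoc, part5_zero_mul, part5_one_mul, part5_two_mul,
    part5_three_mul, part5_four_mul, map_add (part5 _), part5_ofNat_mul, part5_zero_thetaP,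
    part5_zero_thetaZ, part5_one_thetaX, part5_four_thetaY, part5_thetaP, part5_thetaZ,
    part5_thetaX, part5_thetaY, ne_eq, OfNat.ofNat_ne_zero, OfNat.zero_ne_ofNat, one_ne_zero,
    zero_ne_one, OfNat.one_ne_ofNat, OfNat.ofNat_ne_one, not_false_eq_true, mul_zero, zero_mul,
    add_zero, zero_add, Nat.reduceEqDiff] at h
  simp only [map_add, map_mul, map_ofNat] at h
  -- 3 is the inverse of 2 mod 5.
  linear_combination 3 * h + (-(red (part5 2 genFunTwo) * red thetaP) +
    2 * red thetaX * red thetaY ^ 4 +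
    4 * red thetaZ ^ 3 * red thetaX ^ 2 + 3 * red thetaZ ^ 2 * red thetaY ^ 3 +
    4 * red thetaZ * red thetaX ^ 3 * red thetaY) * five_eq_zero

theorem red_part5_three_genFunTwo_mul : red (part5 3 genFunTwo) * red thetaP =
    -(red thetaY * (red thetaX ^ 4 - red thetaZ ^ 3 * red thetaY +
      2 * red thetaZ * red thetaY ^ 2 * red thetaX)) := by
  have h := congrArg (part5 3) red_genFunTwo_mul_thetaP
  rw [red, part5_map, part5_map] at h
  simp only [pow_succ, pow_zero, one_mul, mul_assoc, part5_zero_mul, part5_one_mul, part5_two_mul,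
    part5_three_mul, part5_four_mul, map_add (part5 _), part5_ofNat_mul, part5_zero_thetaP,
    part5_zero_thetaZ, part5_one_thetaX, part5_four_thetaY, part5_thetaP, part5_thetaZ,
    part5_thetaX, part5_thetaY, ne_eq, OfNat.ofNat_ne_zero, OfNat.zero_ne_ofNat, one_ne_zero,
    zero_ne_one, OfNat.one_ne_ofNat, OfNat.ofNat_ne_one, not_false_eq_true, mul_zero, zero_mul,
    add_zero, zero_add, Nat.reduceEqDiff] at h
  simp only [map_add, map_mul, map_ofNat] at h
  linear_combination 3 * h + (-(red (part5 3 genFunTwo) * red thetaP) +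
    2 * red thetaY * red thetaX ^ 4 +
    4 * red thetaZ ^ 3 * red thetaY ^ 2 + 3 * red thetaZ ^ 2 * red thetaX ^ 3 +
    4 * red thetaZ * red thetaY ^ 3 * red thetaX) * five_eq_zero

theorem red_evalNegHom (f : ℤ⟦X⟧) : red (evalNegHom f) = evalNegHom (red f) :=
  map_evalNegHom _ f

theorem red_ne_zero_of_coeff {f : ℤ⟦X⟧} (n : ℕ) (h : ¬ (5 : ℤ) ∣ coeff n f) : red f ≠ 0 := by
  intro h0
  have hc := congrArg (coeff n) h0
  rw [coeff_map, map_zero, eq_intCast] at hc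
  exact h (by exact_mod_cast (ZMod.intCast_zmod_eq_zero_iff_dvd _ 5).1 hc)

theorem red_thetaX_ne_zero : red thetaX ≠ 0 :=
  red_ne_zero_of_coeff 1 (by rw [coeff_thetaX_one]; decide)

theorem red_thetaY_ne_zero : red thetaY ≠ 0 :=
  red_ne_zero_of_coeff 4 (by rw [coeff_thetaY_four]; decide)

theorem red_thetaP_ne_zero : red thetaP ≠ 0 :=
  red_ne_zero_of_coeff 0 (by
    rw [thetaP, coeff_expand, if_pos (by decide), Nat.zero_div, coeff_phiNeg_zero]
    decide)

theorem isDomain_zmod_five : IsDomain (ZMod 5)⟦X⟧ := by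
  have : Fact (Nat.Prime 5) := ⟨by decide⟩
  infer_instance

theorem evalNegHom_eq_self_of_mul {f a c : (ZMod 5)⟦X⟧} (ha : a ≠ 0) (h : f * a = -c)
    (hc : c * evalNegHom a = evalNegHom c * a) : evalNegHom f = f := by
  have := isDomain_zmod_five
  have h' : evalNegHom f * evalNegHom a = -evalNegHom c := by
    rw [← map_mul, h, map_neg]
  refine mul_right_cancel₀ (mul_ne_zero ha (evalNegHom_ne_zero ha)) ?_
  linear_combination a * h' - evalNegHom a * h + hc

theorem red_thetaX_mul_thetaY :
    red thetaX * red thetaY = red thetaP ^ 2 - red thetaZ ^ 2 := by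
  have h := congrArg red thetaX_mul_thetaY
  simpa only [map_mul, map_add, map_sub, map_pow, map_ofNat, red_evalNegHom] using h

theorem red_neg_thetaX_mul_neg_thetaY :
    evalNegHom (red thetaX) * evalNegHom (red thetaY) =
      evalNegHom (red thetaP) ^ 2 - evalNegHom (red thetaZ) ^ 2 := by
  have h := congrArg red neg_thetaX_mul_neg_thetaY
  simpa only [map_mul, map_add, map_sub, map_pow, map_ofNat, red_evalNegHom] using h

theorem red_thetaX_mul_neg_thetaY :
    red thetaX * evalNegHom (red thetaY) =
      (red thetaP - red thetaZ) * (evalNegHom (red thetaP) + evalNegHom (red thetaZ)) := by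
  have h := congrArg red thetaX_mul_neg_thetaY
  simpa only [map_mul, map_add, map_sub, map_pow, map_ofNat, red_evalNegHom] using h

theorem red_neg_thetaX_mul_thetaY :
    evalNegHom (red thetaX) * red thetaY =
      (red thetaP + red thetaZ) * (evalNegHom (red thetaP) - evalNegHom (red thetaZ)) := by
  have h := congrArg red neg_thetaX_mul_thetaY
  simpa only [map_mul, map_add, map_sub, map_pow, map_ofNat, red_evalNegHom] using h

theorem red_sq_thetaX_mul_sq_neg :
    red thetaX ^ 2 * evalNegHom (red thetaX) ^ 2 = 4 * red thetaZ * evalNegHom (red thetaZ) *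
      (red thetaZ * evalNegHom (red thetaY) + evalNegHom (red thetaZ) * red thetaY) := by
  have h := congrArg red sq_thetaX_mul_sq_neg
  simpa only [map_mul, map_add, map_sub, map_pow, map_ofNat, red_evalNegHom] using h

theorem red_sq_thetaY_mul_sq_neg :
    red thetaY ^ 2 * evalNegHom (red thetaY) ^ 2 = 4 * red thetaZ * evalNegHom (red thetaZ) *
      (red thetaZ * evalNegHom (red thetaX) + evalNegHom (red thetaZ) * red thetaX) := by
  have h := congrArg red sq_thetaY_mul_sq_neg
  simpa only [map_mul, map_add, map_sub, map_pow, map_ofNat, red_evalNegHom] using h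

theorem red_sq_sub_sq_mul_neg :
    (red thetaP ^ 2 - red thetaZ ^ 2) *
        (evalNegHom (red thetaP) ^ 2 - evalNegHom (red thetaZ) ^ 2) =
      4 * red thetaZ * evalNegHom (red thetaZ) *
        (red thetaP * evalNegHom (red thetaP) - red thetaZ * evalNegHom (red thetaZ)) := by
  have h := congrArg red sq_sub_sq_mul_neg
  simpa only [map_mul, map_add, map_sub, map_pow, map_ofNat, red_evalNegHom] using h

theorem evalNegHom_red_part5_two :
    evalNegHom (red (part5 2 genFunTwo)) = red (part5 2 genFunTwo) := by
  have := isDomain_zmod_five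
  refine evalNegHom_eq_self_of_mul red_thetaP_ne_zero red_part5_two_genFunTwo_mul ?_
  simp only [map_mul, map_add, map_sub, map_pow, map_ofNat]
  refine cofactor_mul_eq_of_five_eq_zero five_eq_zero red_thetaX_ne_zero red_thetaY_ne_zero
    (evalNegHom_ne_zero red_thetaX_ne_zero) (evalNegHom_ne_zero red_thetaY_ne_zero)
    (evalNegHom_ne_zero red_thetaP_ne_zero) (by rw [red_thetaZ, map_pow, mul_comm])
    red_thetaX_mul_thetaY red_neg_thetaX_mul_neg_thetaY red_thetaX_mul_neg_thetaY
    red_neg_thetaX_mul_thetaY red_sq_thetaX_mul_sq_neg red_sq_sub_sq_mul_neg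

theorem evalNegHom_red_part5_three :
    evalNegHom (red (part5 3 genFunTwo)) = red (part5 3 genFunTwo) := by
  have := isDomain_zmod_five
  refine evalNegHom_eq_self_of_mul red_thetaP_ne_zero red_part5_three_genFunTwo_mul ?_
  simp only [map_mul, map_add, map_sub, map_pow, map_ofNat]
  have hab : red thetaP ^ 5 * evalNegHom (red thetaZ) =
      evalNegHom (red thetaP) ^ 5 * red thetaZ := by
    rw [red_thetaZ, map_pow, mul_comm]
  -- The same symmetry, exchanging $X$ and $Y$ with all signs reversed except those of $P(\pm q)$,
  -- carries the part 2 cofactor to minus the part 3 cofactor.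
  have h := cofactor_mul_eq_of_five_eq_zero (a := red thetaP) (b := evalNegHom (red thetaP))
    (z := -red thetaZ) (w := -evalNegHom (red thetaZ)) (x := -red thetaY) (y := -red thetaX)
    (s := -evalNegHom (red thetaY)) (t := -evalNegHom (red thetaX)) five_eq_zero
    (neg_ne_zero.2 red_thetaY_ne_zero) (neg_ne_zero.2 red_thetaX_ne_zero)
    (neg_ne_zero.2 (evalNegHom_ne_zero red_thetaY_ne_zero))
    (neg_ne_zero.2 (evalNegHom_ne_zero red_thetaX_ne_zero))
    (evalNegHom_ne_zero red_thetaP_ne_zero) (by linear_combination -hab)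
    (by linear_combination red_thetaX_mul_thetaY)
    (by linear_combination red_neg_thetaX_mul_neg_thetaY)
    (by linear_combination red_neg_thetaX_mul_thetaY)
    (by linear_combination red_thetaX_mul_neg_thetaY)
    (by linear_combination red_sq_thetaY_mul_sq_neg)
    (by linear_combination red_sq_sub_sq_mul_neg)
  linear_combination -h

theorem five_dvd_abar5_two_mul {i m : ℕ} (hm : Odd m) (hi : m % 5 = i)
    (h : evalNegHom (red (part5 i genFunTwo)) = red (part5 i genFunTwo)) :
    (5 : ℤ) ∣ abar5 (2 * m) := by
  have hc := congrArg (coeff m) h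
  rw [coeff_evalNegHom, hm.neg_one_pow, coeff_map, coeff_part5, if_pos hi, genFunTwo, coeff_mk,
    eq_intCast] at hc
  have h2 : ((2 * abar5 (2 * m) : ℤ) : ZMod 5) = 0 := by
    push_cast
    linear_combination -hc
  have := (ZMod.intCast_zmod_eq_zero_iff_dvd _ 5).1 h2
  push_cast at this
  omega

end ThetaFive

theorem corollary3 (n : ℕ) (k : ℕ) (hk : 2 ≤ k) :
    abar5 (20 * n + 6) ≡ 0 [ZMOD 10] ∧
    abar5 (20 * n + 14) ≡ 0 [ZMOD 10] ∧
    4 * abar5 (5 ^ k * n) ≡ 5 * abar5 n - abar5 (5 * n) [ZMOD 5 ^ k] := by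
  refine ⟨Int.modEq_zero_iff_dvd.2 ?_, Int.modEq_zero_iff_dvd.2 ?_, ?_⟩
  · have h2 := ThetaFive.two_dvd_abar5 (n := 20 * n + 6) (by omega)
    have h5 := ThetaFive.five_dvd_abar5_two_mul (i := 3) (m := 10 * n + 3) ⟨5 * n + 1, by ring⟩
      (by omega) ThetaFive.evalNegHom_red_part5_three
    rw [show 2 * (10 * n + 3) = 20 * n + 6 by ring] at h5
    omega
  · have h2 := ThetaFive.two_dvd_abar5 (n := 20 * n + 14) (by omega)
    have h5 := ThetaFive.five_dvd_abar5_two_mul (i := 2) (m := 10 * n + 7) ⟨5 * n + 3, by ring⟩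
      (by omega) ThetaFive.evalNegHom_red_part5_two
    rw [show 2 * (10 * n + 7) = 20 * n + 14 by ring] at h5
    omega
  · rw [ThetaFive.four_mul_abar5_five_pow]
    exact (Int.modEq_iff_dvd.2 ⟨abar5 (5 * n) - abar5 n, by ring⟩).symm
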